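/- In this statement, a \emph{graph} $\Gamma$ is either (a) a finite connected multigraph without loop edges, whose \emph{points} are its vertices, or (b) a connected metric graph, i.e. a compact connected metric space in which every point has a neighbourhood isometric to a star with finitely many rays, centred at that point. A \emph{divisor} on $\Gamma$ is a finite $\mathbb{Z}$-linear combination of points; it is \emph{effective} if all its coefficients are nonnegative, and its \emph{degree} is the sum of its coefficients. Two divisors are \emph{linearly equivalent} if their difference is principal, where the principal divisors are the divisors $\operatorname{div}(f)$: in case (a), $f$ is an integer-valued function on the vertices and the coefficient of $\operatorname{div}(f)$ at $x$ is $\sum_{e = xy} (f(y)-f(x))$, the sum over all edges $e$ at $x$; in case (b), $f$ is a continuous piecewise linear function $\Gamma \to \mathbb{R}$ with integer slopes and the coefficient of $\operatorname{div}(f)$ at $x$ is the sum of the outgoing slopes of $f$ at $x$. The \emph{Baker--Norine rank} $r_\Gamma(D)$ is the largest integer $k \geq -1$ such that for every effective divisor $E$ of degree $k$, the divisor $D-E$ is linearly equivalent to an effective divisor (so $r_\Gamma(D)=-1$ if $D$ is not equivalent to an effective divisor). \textbf{Proposition.} Let $\Gamma_1, \Gamma_2$ be two graphs, both finite or both metric,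 let $w_1$ be a point of $\Gamma_1$ and $v_2$ a point of $\Gamma_2$, and let $\Gamma$ be the vertex gluing, obtained from the disjoint union of $\Gamma_1$ and $\Gamma_2$ by identifying $w_1$ with $v_2$ (in the metric case, with the metric extending those of $\Gamma_1$ and $\Gamma_2$ for which the distance from $x \in \Gamma_1$ to $y \in \Gamma_2$ is $d(x,w_1)+d(v_2,y)$). Let $D_1$ be a divisor on $\Gamma_1$, $D_2$ a divisor on $\Gamma_2$, and let $D = D_1 + D_2$, regarded as a divisor on $\Gamma$. Then the minimum below is attained and $$ r_\Gamma(D) = \min_{\ell \in \mathbb{Z}} \Bigl( r_{\Gamma_1}\bigl(D_1 - (\ell+1) w_1\bigr) + r_{\Gamma_2}\bigl(D_2 + \ell v_2\bigr) + 1 \Bigr). $$ -/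

import Mathlib

namespace ChipFiring

/-! ### Divisors and Baker-Norine rank -/

/-- A divisor on a set of points is an integer combination of finitely many points. -/
abbrev Divisor (P : Type*) := P →₀ ℤ

/-- The degree of a divisor: the sum of its coefficients. -/
def Divisor.degree {P : Type*} (D : Divisor P) : ℤ := D.sum fun _ n => n

/-- The Baker-Norine rank of `D`, relative to the notion `IsPrincipal` of principal divisor
(two divisors are linearly equivalent when their difference is principal; effective means `0 ≤ E`):
the largest integer `k ≥ -1` such that, for every effective divisor `E` of degree `k`, the divisor
`D - E` is linearly equivalent to an effective divisor. The value `k = -1` always qualifies since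
there is no effective divisor of degree `-1`. -/
noncomputable def bakerNorineRank {P : Type*} (IsPrincipal : Divisor P → Prop)
    (D : Divisor P) : ℤ :=
  sSup {k : ℤ | -1 ≤ k ∧ ∀ E : Divisor P, 0 ≤ E → E.degree = k →
    ∃ F : Divisor P, 0 ≤ F ∧ IsPrincipal (D - E - F)}

/-! ### Finite graphs -/

section FiniteGraph

open scoped Graph

variable {α β : Type*}

/-- A finite connected (nonempty) multigraph without loop edges. -/
structure IsFiniteConnectedGraph (G : Graph α β) : Prop where
  finite_vertexSet : V(G).Finite
  finite_edgeSet : E(G).Finite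
  loopless : G.Loopless
  nonempty : V(G).Nonempty
  connected : ∀ x ∈ V(G), ∀ y ∈ V(G), Relation.ReflTransGen G.Adj x y

/-- The value at `x` of the principal divisor of `f`: the sum of `f y - f x` over all edges from
`x` to another vertex `y`, edges being counted with multiplicity. -/
noncomputable def graphDiv (G : Graph α β) (f : V(G) → ℤ) (x : V(G)) : ℤ :=
  ∑ᶠ y : V(G), (Set.ncard {e | G.IsLink e x y} : ℤ) * (f y - f x)

/-- Principal divisors on a finite graph: those of integer functions on the vertices,
that is, the results of sequences of chip-firing moves. -/
def IsGraphPrincipal (G : Graph α β) (D : Divisor V(G)) : Prop :=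
  ∃ f : V(G) → ℤ, ∀ x, D x = graphDiv G f x

/-- The Baker-Norine rank on a finite graph. -/
noncomputable def graphRank (G : Graph α β) (D : Divisor V(G)) : ℤ :=
  bakerNorineRank (IsGraphPrincipal G) D

variable {α₁ α₂ β₁ β₂ : Type*}

/-- The disjoint union of `α₁` and `α₂` with `w` and `v` identified. -/
def Wedge (w : α₁) (v : α₂) : Type _ :=
  Quot fun p q : α₁ ⊕ α₂ => p = Sum.inl w ∧ q = Sum.inr v

/-- The map of the first set to the wedge. -/
def Wedge.left (w : α₁) (v : α₂) (x : α₁) : Wedge w v := Quot.mk _ (Sum.inl x)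

/-- The map of the second set to the wedge. -/
def Wedge.right (w : α₁) (v : α₂) (x : α₂) : Wedge w v := Quot.mk _ (Sum.inr x)

/-- The vertex gluing of two graphs: the disjoint union with the vertex `w` of the first
identified with the vertex `v` of the second. -/
def glueGraph (G₁ : Graph α₁ β₁) (G₂ : Graph α₂ β₂) (w : V(G₁)) (v : V(G₂)) :
    Graph (Wedge w.1 v.1) (β₁ ⊕ β₂) where
  vertexSet := Wedge.left w.1 v.1 '' V(G₁) ∪ Wedge.right w.1 v.1 '' V(G₂)
  IsLink e x y := Sum.elim
    (fun e₁ => ∃ a b, G₁.IsLink e₁ a b ∧ Wedge.left w.1 v.1 a = x ∧ Wedge.left w.1 v.1 b = y)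
    (fun e₂ => ∃ a b, G₂.IsLink e₂ a b ∧ Wedge.right w.1 v.1 a = x ∧ Wedge.right w.1 v.1 b = y) e
  isLink_symm := by
    rintro (e | e) - <;> constructor <;> rintro x y ⟨a, b, h, ha, hb⟩ <;>
      exact ⟨b, a, h.symm, hb, ha⟩
  eq_or_eq_of_isLink_of_isLink := by
    rintro (e | e) x y x' y' ⟨a, b, h, rfl, rfl⟩ ⟨a', b', h', rfl, rfl⟩
    · rcases G₁.eq_or_eq_of_isLink_of_isLink h h' with rfl | rfl <;> simp
    · rcases G₂.eq_or_eq_of_isLink_of_isLink h h' with rfl | rfl <;> simp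
  left_mem_of_isLink := by
    rintro (e | e) x y ⟨a, b, h, rfl, rfl⟩
    · exact Or.inl ⟨a, h.left_mem, rfl⟩
    · exact Or.inr ⟨a, h.left_mem, rfl⟩

/-- The inclusion of the vertices of the first graph in those of the vertex gluing. -/
def glueGraphLeft (G₁ : Graph α₁ β₁) (G₂ : Graph α₂ β₂) (w : V(G₁)) (v : V(G₂)) (x : V(G₁)) :
    V(glueGraph G₁ G₂ w v) :=
  ⟨Wedge.left w.1 v.1 x.1, Or.inl ⟨x.1, x.2, rfl⟩⟩

/-- The inclusion of the vertices of the second graph in those of the vertex gluing. -/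
def glueGraphRight (G₁ : Graph α₁ β₁) (G₂ : Graph α₂ β₂) (w : V(G₁)) (v : V(G₂)) (x : V(G₂)) :
    V(glueGraph G₁ G₂ w v) :=
  ⟨Wedge.right w.1 v.1 x.1, Or.inr ⟨x.1, x.2, rfl⟩⟩

end FiniteGraph

/-! ### Metric graphs -/

section MetricGraph

variable {X : Type*} [MetricSpace X]

/-- `IsStarChart x n r φ`: the open ball of radius `r` around `x` is isometric to the star with `n`
rays `[0, r)` glued at `0` (with the path metric), the centre corresponding to `x`; the point at
distance `t` from the centre on the `i`-th ray corresponds to `φ i t`. The values of `φ i` outside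
`[0, r)` are irrelevant. -/
structure IsStarChart (x : X) (n : ℕ) (r : ℝ) (φ : Fin n → ℝ → X) : Prop where
  pos : 0 < r
  center : ∀ i, φ i 0 = x
  dist_same : ∀ i, ∀ s ∈ Set.Ico 0 r, ∀ t ∈ Set.Ico 0 r, dist (φ i s) (φ i t) = |s - t|
  dist_ne : ∀ i j, i ≠ j → ∀ s ∈ Set.Ico 0 r, ∀ t ∈ Set.Ico 0 r, dist (φ i s) (φ j t) = s + t
  surj : ∀ y, dist y x < r → y = x ∨ ∃ i, ∃ t ∈ Set.Ico 0 r, φ i t = y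

variable (X) in
/-- A connected metric graph: a compact connected metric space in which every point `x` has a
neighbourhood isometric to a star with finitely many rays (the valence of `x`). -/
class IsMetricGraph : Prop extends CompactSpace X, ConnectedSpace X where
  exists_star : ∀ x : X, ∃ (n : ℕ) (r : ℝ) (φ : Fin n → ℝ → X), IsStarChart x n r φ

/-- Near `x`, the function `f` is affine with integer slope along each ray leaving `x`, and the sum
of these outgoing slopes is `k`. -/
def HasOrdAt (f : X → ℝ) (x : X) (k : ℤ) : Prop :=
  ∃ (n : ℕ) (r : ℝ) (φ : Fin n → ℝ → X) (m : Fin n → ℤ), IsStarChart x n r φ ∧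
    (∀ i, ∀ t ∈ Set.Ico 0 r, f (φ i t) = f x + m i * t) ∧ ∑ i, m i = k

/-- Principal divisors on a metric graph: those of rational functions, i.e. continuous piecewise
linear functions with integer slopes (the pieces are finite in number by compactness). The
coefficient at `x` is the sum of the outgoing slopes at `x`. -/
def IsMetricPrincipal (D : Divisor X) : Prop :=
  ∃ f : X → ℝ, ∀ x, HasOrdAt f x (D x)

/-- The Baker-Norine rank on a metric graph. -/
noncomputable def metricRank (D : Divisor X) : ℤ :=
  bakerNorineRank IsMetricPrincipal D

variable {X₁ X₂ : Type*} [MetricSpace X₁] [MetricSpace X₂]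

/-- The vertex gluing of two metric graphs: the points `w` and `v` are identified, the distance
from `x` in the first to `y` in the second being `dist x w + dist y v`. -/
abbrev GlueMetric (w : X₁) (v : X₂) : Type _ :=
  Metric.GlueSpace (isometry_subsingleton (f := fun _ : Unit => w))
    (isometry_subsingleton (f := fun _ : Unit => v))

/-- The inclusion of the first metric graph in the vertex gluing. -/
noncomputable def glueMetricLeft (w : X₁) (v : X₂) (x : X₁) : GlueMetric w v := Metric.toGlueL _ _ x

/-- The inclusion of the second metric graph in the vertex gluing. -/
noncomputable def glueMetricRight (w : X₁) (v : X₂) (x : X₂) : GlueMetric w v := Metric.toGlueR _ _ x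

end MetricGraph

end ChipFiring

namespace ChipFiring

/-! ### The Baker-Norine rank for an abstract notion of principal divisor -/

section Rank

variable {P : Type*} {IsPrincipal : Divisor P → Prop}

/-! The formula rests on two properties of principal divisors, `SplitsPrincipal` and `BoundedAt`;
everything else is formal. A function on the gluing is a pair of functions agreeing at the common
point, which a constant shift always achieves, and its order there is the sum of the two orders.
Hence, for `E = E₁ + E₂`, the divisor `D - E` is equivalent to an effective one iff some integer `c`
makes both `D₁ - E₁ + c w` and `D₂ - E₂ - c v` so. The good `c` form an up-set on the first side and
a down-set on the second. These are disjoint exactly when, for some `l`, `-(l + 1)` misses the first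
and `-l` misses the second, that is, when `E₁` obstructs `D₁ - (l + 1) w` and `E₂` obstructs `D₂ + l
v`. The least degree of an obstruction is the rank plus one, so minimising `deg E₁ + deg E₂` gives
the formula (`isLeast_bakerNorineRank`). `BoundedAt` makes suprema attained and keeps the up-set and
the down-set from being all of `ℤ`. For finite graphs it holds because principal divisors have
degree zero. For metric graphs a descent along steep slopes (`IsMetricGraph.boundedAt`) replaces the
degree computation. -/

theorem Divisor.degree_add (D E : Divisor P) : (D + E).degree = D.degree + E.degree :=
  Finsupp.sum_add_index' (fun _ => rfl) fun _ _ _ => rfl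

@[simp] theorem Divisor.degree_single (x : P) (n : ℤ) :
    Divisor.degree (Finsupp.single x n) = n :=
  Finsupp.sum_single_index rfl

@[simp] theorem Divisor.degree_zero : Divisor.degree (0 : Divisor P) = 0 :=
  Finsupp.sum_zero_index

theorem Divisor.degree_mapDomain {Q : Type*} (i : P → Q) (D : Divisor P) :
    Divisor.degree (D.mapDomain i) = D.degree :=
  Finsupp.sum_mapDomain_index (fun _ => rfl) fun _ _ _ => rfl

theorem Divisor.degree_nonneg {D : Divisor P} (hD : 0 ≤ D) : 0 ≤ D.degree :=
  Finset.sum_nonneg fun x _ => hD x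

/-- The divisor `D` is linearly equivalent to an effective divisor. -/
def EquivEffective (IsPrincipal : Divisor P → Prop) (D : Divisor P) : Prop :=
  ∃ F : Divisor P, 0 ≤ F ∧ IsPrincipal (D - F)

theorem EquivEffective.add {D E : Divisor P} (h : EquivEffective IsPrincipal D) (hE : 0 ≤ E) :
    EquivEffective IsPrincipal (D + E) := by
  obtain ⟨F, hF, hp⟩ := h
  refine ⟨F + E, add_nonneg hF hE, ?_⟩
  rwa [add_sub_add_right_eq_sub]

/-- No divisor is equivalent to an effective one after subtracting a large multiple of `w`. -/
def BoundedAt (IsPrincipal : Divisor P → Prop) (w : P) : Prop :=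
  ∀ D : Divisor P, ∃ K : ℤ, ∀ k, K ≤ k →
    ¬ EquivEffective IsPrincipal (D - Finsupp.single w k)

/-- Testing against multiples of `w` bounds the set in the definition, so its `sSup` is attained (an
unbounded set would get the default value 0). For smaller `k`, a test divisor is padded by a
multiple of `w` up to the degree of the rank. -/
theorem BoundedAt.le_bakerNorineRank_iff {w : P} (hw : BoundedAt IsPrincipal w) (D : Divisor P)
    {k : ℤ} (hk : -1 ≤ k) :
    k ≤ bakerNorineRank IsPrincipal D ↔
      ∀ E : Divisor P, 0 ≤ E → E.degree = k → EquivEffective IsPrincipal (D - E) := by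
  set S := {k : ℤ | -1 ≤ k ∧ ∀ E : Divisor P, 0 ≤ E → E.degree = k →
    ∃ F : Divisor P, 0 ≤ F ∧ IsPrincipal (D - E - F)}
  have hne : S.Nonempty := ⟨-1, le_rfl, fun E hE hd => by
    have := Divisor.degree_nonneg hE
    omega⟩
  have hbdd : BddAbove S := by
    obtain ⟨K, hK⟩ := hw D
    refine ⟨max K 0, fun k hk => ?_⟩
    by_contra! hlt
    refine hK k (by omega) (hk.2 _ ?_ (Divisor.degree_single _ _))
    exact Finsupp.single_nonneg.2 (by omega)
  refine ⟨fun hle E hE hd => ?_, fun h => le_csSup hbdd ⟨hk, h⟩⟩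
  have hmem : bakerNorineRank IsPrincipal D ∈ S := Int.csSup_mem hne hbdd
  have hsing : (0 : Divisor P) ≤ Finsupp.single w (bakerNorineRank IsPrincipal D - k) :=
    Finsupp.single_nonneg.2 (by omega)
  have h : EquivEffective IsPrincipal _ := hmem.2 _ (add_nonneg hE hsing)
    (by rw [Divisor.degree_add, Divisor.degree_single]; omega)
  have h' := h.add hsing
  rwa [← sub_sub, sub_add_cancel] at h'

theorem BoundedAt.neg_one_le_bakerNorineRank {w : P} (hw : BoundedAt IsPrincipal w)
    (D : Divisor P) : -1 ≤ bakerNorineRank IsPrincipal D :=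
  (hw.le_bakerNorineRank_iff D le_rfl).2 fun E hE hd => by
    have := Divisor.degree_nonneg hE
    omega

theorem BoundedAt.bakerNorineRank_lt_iff {w : P} (hw : BoundedAt IsPrincipal w) (D : Divisor P)
    {k : ℤ} (hk : -1 ≤ k) :
    bakerNorineRank IsPrincipal D < k ↔
      ∃ E : Divisor P, 0 ≤ E ∧ E.degree = k ∧ ¬ EquivEffective IsPrincipal (D - E) := by
  rw [← not_le, hw.le_bakerNorineRank_iff D hk]
  push Not
  rfl

end Rank

/-! ### Divisors on a union of two sets of points meeting in one point -/

section Gluing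

variable {P P₁ P₂ : Type*}

/-- The set of points `P` is the union of `P₁` and `P₂`, which have only the point `w = v`
in common. -/
structure IsPointGluing (i₁ : P₁ → P) (i₂ : P₂ → P) (w : P₁) (v : P₂) : Prop where
  inj_left : Function.Injective i₁
  inj_right : Function.Injective i₂
  point : i₁ w = i₂ v
  cover : ∀ x, (∃ a, i₁ a = x) ∨ ∃ b, i₂ b = x
  meet : ∀ a b, i₁ a = i₂ b → a = w ∧ b = v

namespace IsPointGluing

variable {i₁ : P₁ → P} {i₂ : P₂ → P} {w : P₁} {v : P₂}

theorem symm (h : IsPointGluing i₁ i₂ w v) : IsPointGluing i₂ i₁ v w where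
  inj_left := h.inj_right
  inj_right := h.inj_left
  point := h.point.symm
  cover x := (h.cover x).symm
  meet a b hab := (h.meet b a hab.symm).symm

theorem notMem_range (h : IsPointGluing i₁ i₂ w v) {a : P₁} (ha : a ≠ w) :
    i₁ a ∉ Set.range i₂ := by
  rintro ⟨b, hb⟩
  exact ha (h.meet a b hb.symm).1

theorem add_apply_left (h : IsPointGluing i₁ i₂ w v) (E₁ : Divisor P₁) (E₂ : Divisor P₂) {a : P₁}
    (ha : a ≠ w) : (E₁.mapDomain i₁ + E₂.mapDomain i₂) (i₁ a) = E₁ a := by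
  rw [Finsupp.add_apply, Finsupp.mapDomain_apply h.inj_left,
    Finsupp.mapDomain_of_notMem_range _ _ (h.notMem_range ha), add_zero]

theorem add_apply_right (h : IsPointGluing i₁ i₂ w v) (E₁ : Divisor P₁) (E₂ : Divisor P₂) {b : P₂}
    (hb : b ≠ v) : (E₁.mapDomain i₁ + E₂.mapDomain i₂) (i₂ b) = E₂ b := by
  rw [add_comm, h.symm.add_apply_left _ _ hb]

theorem add_apply_point (h : IsPointGluing i₁ i₂ w v) (E₁ : Divisor P₁) (E₂ : Divisor P₂) :
    (E₁.mapDomain i₁ + E₂.mapDomain i₂) (i₁ w) = E₁ w + E₂ v := by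
  rw [Finsupp.add_apply, Finsupp.mapDomain_apply h.inj_left, h.point,
    Finsupp.mapDomain_apply h.inj_right]

theorem exists_effective_add (h : IsPointGluing i₁ i₂ w v) {E : Divisor P} (hE : 0 ≤ E) :
    ∃ (E₁ : Divisor P₁) (E₂ : Divisor P₂), 0 ≤ E₁ ∧ 0 ≤ E₂ ∧
      E = E₁.mapDomain i₁ + E₂.mapDomain i₂ := by
  classical
  -- The whole coefficient at the common point goes to the first part; erasing `v` avoids counting
  -- it twice.
  refine ⟨E.comapDomain i₁ h.inj_left.injOn, (E.comapDomain i₂ h.inj_right.injOn).erase v,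
    fun a => hE (i₁ a), fun b => ?_, ?_⟩
  · rw [Finsupp.erase_apply]
    split_ifs
    exacts [le_rfl, hE (i₂ b)]
  · have hw : E (i₁ w) = (((E.comapDomain i₁ h.inj_left.injOn).mapDomain i₁) +
        ((E.comapDomain i₂ h.inj_right.injOn).erase v).mapDomain i₂) (i₁ w) := by
      rw [h.add_apply_point, Finsupp.erase_same, add_zero, Finsupp.comapDomain_apply]
    ext x
    rcases h.cover x with ⟨a, rfl⟩ | ⟨b, rfl⟩
    · by_cases ha : a = w
      · rw [ha, hw]
      · rw [h.add_apply_left _ _ ha, Finsupp.comapDomain_apply]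
    · by_cases hb : b = v
      · rw [hb, ← h.point, hw]
      · rw [h.add_apply_right _ _ hb, Finsupp.erase_ne hb, Finsupp.comapDomain_apply]

theorem exists_extension (h : IsPointGluing i₁ i₂ w v) {Z : Type*} (f₁ : P₁ → Z) (f₂ : P₂ → Z)
    (hf : f₁ w = f₂ v) : ∃ f : P → Z, (∀ a, f (i₁ a) = f₁ a) ∧ ∀ b, f (i₂ b) = f₂ b := by
  have hex (x : P) : ∃ z, (∀ a, i₁ a = x → z = f₁ a) ∧ ∀ b, i₂ b = x → z = f₂ b := by
    rcases h.cover x with ⟨a, rfl⟩ | ⟨b, rfl⟩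
    · refine ⟨f₁ a, fun a' ha => by rw [h.inj_left ha], fun b hb => ?_⟩
      obtain ⟨rfl, rfl⟩ := h.meet _ _ hb.symm
      exact hf
    · refine ⟨f₂ b, fun a ha => ?_, fun b' hb => by rw [h.inj_right hb]⟩
      obtain ⟨rfl, rfl⟩ := h.meet _ _ ha
      exact hf.symm
  choose f hf using hex
  exact ⟨f, fun a => (hf _).1 a rfl, fun b => (hf _).2 b rfl⟩

variable {Pr : Divisor P → Prop} {Pr₁ : Divisor P₁ → Prop} {Pr₂ : Divisor P₂ → Prop}

/-- Principal divisors on the gluing are the sums of principal divisors on the two parts. -/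
def SplitsPrincipal (i₁ : P₁ → P) (i₂ : P₂ → P) (w : P₁) (v : P₂) (Pr : Divisor P → Prop)
    (Pr₁ : Divisor P₁ → Prop) (Pr₂ : Divisor P₂ → Prop) : Prop :=
  ∀ (E₁ : Divisor P₁) (E₂ : Divisor P₂), Pr (E₁.mapDomain i₁ + E₂.mapDomain i₂) ↔
    ∃ c : ℤ, Pr₁ (E₁ + Finsupp.single w c) ∧ Pr₂ (E₂ - Finsupp.single v c)

theorem equivEffective_add_iff (h : IsPointGluing i₁ i₂ w v)
    (hs : SplitsPrincipal i₁ i₂ w v Pr Pr₁ Pr₂) (D₁ : Divisor P₁) (D₂ : Divisor P₂) :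
    EquivEffective Pr (D₁.mapDomain i₁ + D₂.mapDomain i₂) ↔
      ∃ c : ℤ, EquivEffective Pr₁ (D₁ + Finsupp.single w c) ∧
        EquivEffective Pr₂ (D₂ - Finsupp.single v c) := by
  have key (F₁ : Divisor P₁) (F₂ : Divisor P₂) :
      D₁.mapDomain i₁ + D₂.mapDomain i₂ - (F₁.mapDomain i₁ + F₂.mapDomain i₂) =
        (D₁ - F₁).mapDomain i₁ + (D₂ - F₂).mapDomain i₂ := by
    rw [Finsupp.mapDomain_sub, Finsupp.mapDomain_sub]
    abel
  constructor
  · rintro ⟨F, hF, hp⟩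
    obtain ⟨F₁, F₂, hF₁, hF₂, rfl⟩ := h.exists_effective_add hF
    rw [key, hs] at hp
    obtain ⟨c, h₁, h₂⟩ := hp
    exact ⟨c, ⟨F₁, hF₁, by rwa [add_sub_right_comm]⟩, ⟨F₂, hF₂, by rwa [sub_right_comm]⟩⟩
  · rintro ⟨c, ⟨F₁, hF₁, h₁⟩, ⟨F₂, hF₂, h₂⟩⟩
    refine ⟨F₁.mapDomain i₁ + F₂.mapDomain i₂,
      add_nonneg (Finsupp.mapDomain_nonneg hF₁) (Finsupp.mapDomain_nonneg hF₂), ?_⟩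
    rw [key, hs]
    exact ⟨c, by rwa [add_sub_right_comm] at h₁, by rwa [sub_right_comm] at h₂⟩

theorem boundedAt (h : IsPointGluing i₁ i₂ w v) (hs : SplitsPrincipal i₁ i₂ w v Pr Pr₁ Pr₂)
    (h₁ : BoundedAt Pr₁ w) (h₂ : BoundedAt Pr₂ v) : BoundedAt Pr (i₁ w) := by
  intro D
  obtain ⟨D₁, D₂, rfl⟩ : ∃ (D₁ : Divisor P₁) (D₂ : Divisor P₂),
      D = D₁.mapDomain i₁ + D₂.mapDomain i₂ := by
    obtain ⟨A₁, A₂, -, -, hA⟩ := h.exists_effective_add (E := D⁺) (posPart_nonneg D)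
    obtain ⟨B₁, B₂, -, -, hB⟩ := h.exists_effective_add (E := D⁻) (negPart_nonneg D)
    refine ⟨A₁ - B₁, A₂ - B₂, ?_⟩
    rw [← posPart_sub_negPart D, hA, hB, Finsupp.mapDomain_sub, Finsupp.mapDomain_sub]
    abel
  obtain ⟨K₁, hK₁⟩ := h₁ D₁
  obtain ⟨K₂, hK₂⟩ := h₂ D₂
  refine ⟨K₁ + K₂, fun k hk heff => ?_⟩
  have : D₁.mapDomain i₁ + D₂.mapDomain i₂ - Finsupp.single (i₁ w) k =
      (D₁ - Finsupp.single w k).mapDomain i₁ + D₂.mapDomain i₂ := by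
    rw [Finsupp.mapDomain_sub, Finsupp.mapDomain_single]
    abel
  rw [this, h.equivEffective_add_iff hs] at heff
  obtain ⟨c, e₁, e₂⟩ := heff
  -- The `k` chips taken at the common point are shared as `k - c` and `c`; as `k ≥ K₁ + K₂`, one
  -- share reaches its bound.
  have hc : c < K₂ := by
    by_contra! hc
    exact hK₂ c hc e₂
  refine hK₁ (k - c) (by omega) ?_
  rwa [Finsupp.single_sub, ← sub_add]

theorem isLeast_bakerNorineRank (h : IsPointGluing i₁ i₂ w v)
    (hs : SplitsPrincipal i₁ i₂ w v Pr Pr₁ Pr₂) (h₁ : BoundedAt Pr₁ w) (h₂ : BoundedAt Pr₂ v)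
    (D₁ : Divisor P₁) (D₂ : Divisor P₂) :
    IsLeast (Set.range fun l : ℤ => bakerNorineRank Pr₁ (D₁ - Finsupp.single w (l + 1)) +
        bakerNorineRank Pr₂ (D₂ + Finsupp.single v l) + 1)
      (bakerNorineRank Pr (D₁.mapDomain i₁ + D₂.mapDomain i₂)) := by
  have hb := h.boundedAt hs h₁ h₂
  set D := D₁.mapDomain i₁ + D₂.mapDomain i₂ with hD
  have key (E₁ : Divisor P₁) (E₂ : Divisor P₂) :
      EquivEffective Pr (D - (E₁.mapDomain i₁ + E₂.mapDomain i₂)) ↔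
        ∃ c : ℤ, EquivEffective Pr₁ (D₁ - E₁ + Finsupp.single w c) ∧
          EquivEffective Pr₂ (D₂ - E₂ - Finsupp.single v c) := by
    rw [← h.equivEffective_add_iff hs, hD, Finsupp.mapDomain_sub, Finsupp.mapDomain_sub]
    congr! 1
    abel
  have mono₁ {A : Divisor P₁} {m n : ℤ} (hmn : m ≤ n)
      (hA : EquivEffective Pr₁ (A + Finsupp.single w m)) :
      EquivEffective Pr₁ (A + Finsupp.single w n) := by
    have := hA.add (E := Finsupp.single w (n - m)) (Finsupp.single_nonneg.2 (by omega))
    rwa [add_assoc, ← Finsupp.single_add, add_sub_cancel] at this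
  have mono₂ {A : Divisor P₂} {m n : ℤ} (hmn : n ≤ m)
      (hA : EquivEffective Pr₂ (A - Finsupp.single v m)) :
      EquivEffective Pr₂ (A - Finsupp.single v n) := by
    have := hA.add (E := Finsupp.single v (m - n)) (Finsupp.single_nonneg.2 (by omega))
    rwa [Finsupp.single_sub, sub_add_sub_cancel] at this
  have lower (l : ℤ) : bakerNorineRank Pr D ≤
      bakerNorineRank Pr₁ (D₁ - Finsupp.single w (l + 1)) +
        bakerNorineRank Pr₂ (D₂ + Finsupp.single v l) + 1 := by
    have n₁ := h₁.neg_one_le_bakerNorineRank (D₁ - Finsupp.single w (l + 1))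
    have n₂ := h₂.neg_one_le_bakerNorineRank (D₂ + Finsupp.single v l)
    -- Obstructions of degree one more than each rank; together they obstruct `D`.
    obtain ⟨E₁, hE₁, d₁, e₁⟩ := (h₁.bakerNorineRank_lt_iff _ (by omega)).1
      (lt_add_one (bakerNorineRank Pr₁ (D₁ - Finsupp.single w (l + 1))))
    obtain ⟨E₂, hE₂, d₂, e₂⟩ := (h₂.bakerNorineRank_lt_iff _ (by omega)).1
      (lt_add_one (bakerNorineRank Pr₂ (D₂ + Finsupp.single v l)))
    suffices bakerNorineRank Pr D < (bakerNorineRank Pr₁ (D₁ - Finsupp.single w (l + 1)) + 1) +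
        (bakerNorineRank Pr₂ (D₂ + Finsupp.single v l) + 1) by omega
    refine (hb.bakerNorineRank_lt_iff _ (by omega)).2 ⟨E₁.mapDomain i₁ + E₂.mapDomain i₂,
      add_nonneg (Finsupp.mapDomain_nonneg hE₁) (Finsupp.mapDomain_nonneg hE₂), ?_, ?_⟩
    · rw [Divisor.degree_add, Divisor.degree_mapDomain, Divisor.degree_mapDomain, d₁, d₂]
    · rw [key]
      rintro ⟨c, c₁, c₂⟩
      -- No integer lies strictly between `-(l + 1)` and `-l`, so every `c` contradicts one of the
      -- two obstructions.
      rcases le_or_gt c (-(l + 1)) with hc | hc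
      · apply e₁
        have := mono₁ hc c₁
        rwa [Finsupp.single_neg, ← sub_eq_add_neg, sub_right_comm] at this
      · apply e₂
        have := mono₂ (show -l ≤ c by omega) c₂
        rwa [Finsupp.single_neg, sub_neg_eq_add, ← add_sub_right_comm] at this
  refine ⟨?_, ?_⟩
  swap
  · rintro _ ⟨l, rfl⟩
    exact lower l
  have n := hb.neg_one_le_bakerNorineRank D
  obtain ⟨E, hE, dE, eE⟩ := (hb.bakerNorineRank_lt_iff D (by omega)).1
    (lt_add_one (bakerNorineRank Pr D))
  obtain ⟨E₁, E₂, hE₁, hE₂, rfl⟩ := h.exists_effective_add hE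
  rw [Divisor.degree_add, Divisor.degree_mapDomain, Divisor.degree_mapDomain] at dE
  rw [key] at eE
  push Not at eE
  have d₁ := Divisor.degree_nonneg hE₁
  have d₂ := Divisor.degree_nonneg hE₂
  suffices ∃ l : ℤ, bakerNorineRank Pr₁ (D₁ - Finsupp.single w (l + 1)) < E₁.degree ∧
      bakerNorineRank Pr₂ (D₂ + Finsupp.single v l) < E₂.degree by
    obtain ⟨l, l₁, l₂⟩ := this
    exact ⟨l, le_antisymm (by dsimp only; omega) (lower l)⟩
  have lt₁ {l : ℤ} (hl : ¬ EquivEffective Pr₁ (D₁ - E₁ + Finsupp.single w (-(l + 1)))) :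
      bakerNorineRank Pr₁ (D₁ - Finsupp.single w (l + 1)) < E₁.degree := by
    refine (h₁.bakerNorineRank_lt_iff _ (by omega)).2 ⟨E₁, hE₁, rfl, ?_⟩
    rwa [Finsupp.single_neg, ← sub_eq_add_neg, sub_right_comm] at hl
  by_cases hex : ∃ l : ℤ, EquivEffective Pr₁ (D₁ - E₁ + Finsupp.single w (-l))
  · obtain ⟨K, hK⟩ := h₁ (D₁ - E₁)
    -- The greatest `l` for which the first side stays effective: at `l + 1` the first side fails,
    -- and at `l` the second must fail, since `E₁ + E₂` is an obstruction.
    obtain ⟨l, hl, hmax⟩ := Int.exists_greatest_of_bdd ⟨K, fun l hl => by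
      by_contra! hlt
      refine hK l hlt.le ?_
      rwa [Finsupp.single_neg, ← sub_eq_add_neg] at hl⟩ hex
    refine ⟨l, lt₁ fun hl' => ?_, ?_⟩
    · have := hmax _ hl'
      omega
    · refine (h₂.bakerNorineRank_lt_iff _ (by omega)).2 ⟨E₂, hE₂, rfl, ?_⟩
      have := eE _ hl
      rwa [Finsupp.single_neg, sub_neg_eq_add, ← add_sub_right_comm] at this
  · push Not at hex
    obtain ⟨K, hK⟩ := h₂ D₂
    -- The first side fails for every `l`, so `l` is free; `-K` makes the second rank negative, with
    -- `0` as obstruction.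
    refine ⟨-K, lt₁ (hex _), lt_of_lt_of_le
      ((h₂.bakerNorineRank_lt_iff _ (by omega)).2 ⟨0, le_rfl, Divisor.degree_zero, ?_⟩) d₂⟩
    rw [sub_zero, Finsupp.single_neg, ← sub_eq_add_neg]
    exact hK K le_rfl

end IsPointGluing

end Gluing

end ChipFiring

/-! ### Finite graphs: degree of principal divisors and splitting over a vertex gluing. -/

namespace ChipFiring

section FiniteGraph

open scoped Graph

variable {α β α₁ α₂ β₁ β₂ : Type*}

theorem graphDiv_add_const (G : Graph α β) (f : V(G) → ℤ) (c : ℤ) (x : V(G)) :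
    graphDiv G (fun y => f y + c) x = graphDiv G f x := by
  simp only [graphDiv, add_sub_add_right_eq_sub]

/-- The summand is antisymmetric in the two ends of an edge, so the double sum equals its own
negative. -/
theorem sum_graphDiv {G : Graph α β} [Fintype V(G)] (f : V(G) → ℤ) :
    ∑ x, graphDiv G f x = 0 := by
  have h : ∑ x, graphDiv G f x = -∑ x, graphDiv G f x := by
    simp only [graphDiv, finsum_eq_sum_of_fintype]
    conv_lhs => rw [Finset.sum_comm]
    rw [← Finset.sum_neg_distrib]
    refine Finset.sum_congr rfl fun x _ => ?_
    rw [← Finset.sum_neg_distrib]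
    refine Finset.sum_congr rfl fun y _ => ?_
    simp only [Graph.isLink_comm (x := y.1) (y := x.1)]
    ring
  omega

theorem IsFiniteConnectedGraph.boundedAt {G : Graph α β} (hG : IsFiniteConnectedGraph G)
    (w : V(G)) : BoundedAt (IsGraphPrincipal G) w := by
  have := hG.finite_vertexSet.fintype
  intro D
  refine ⟨D.degree + 1, ?_⟩
  rintro k hk ⟨F, hF, f, hf⟩
  have hsum (E : Divisor V(G)) : E.degree = ∑ x, E x :=
    Finsupp.sum_fintype _ _ fun _ => rfl
  have h := sum_graphDiv f
  simp only [← hf] at h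
  rw [← hsum, sub_eq_add_neg, Divisor.degree_add, sub_eq_add_neg, Divisor.degree_add,
    ← Finsupp.single_neg, Divisor.degree_single, hsum (-F)] at h
  simp only [Finsupp.neg_apply, Finset.sum_neg_distrib, ← hsum] at h
  have := Divisor.degree_nonneg hF
  omega

theorem isPointGluing_glueGraph (G₁ : Graph α₁ β₁) (G₂ : Graph α₂ β₂) (w : V(G₁)) (v : V(G₂)) :
    IsPointGluing (glueGraphLeft G₁ G₂ w v) (glueGraphRight G₁ G₂ w v) w v := by
  -- The two retractions collapse the opposite side to the common point; they detect equality in the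
  -- quotient.
  let r₁ : Wedge w.1 v.1 → α₁ := Quot.lift (Sum.elim id fun _ => w.1) (by
    rintro _ _ ⟨rfl, rfl⟩
    rfl)
  let r₂ : Wedge w.1 v.1 → α₂ := Quot.lift (Sum.elim (fun _ => v.1) id) (by
    rintro _ _ ⟨rfl, rfl⟩
    rfl)
  refine ⟨fun a b h => ?_, fun a b h => ?_, Subtype.ext (Quot.sound ⟨rfl, rfl⟩), ?_, fun a b h => ?_⟩
  · exact Subtype.ext (congrArg (fun x => r₁ x.1) h)
  · exact Subtype.ext (congrArg (fun x => r₂ x.1) h)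
  · rintro ⟨_, ⟨a, ha, rfl⟩ | ⟨b, hb, rfl⟩⟩
    · exact Or.inl ⟨⟨a, ha⟩, rfl⟩
    · exact Or.inr ⟨⟨b, hb⟩, rfl⟩
  · exact ⟨Subtype.ext (congrArg (fun x => r₁ x.1) h),
      Subtype.ext (congrArg (fun x => r₂ x.1) h.symm)⟩

/-- The contribution to a principal divisor on a set of points `P` of the edges of a graph whose
vertices are mapped to `P`. -/
noncomputable def mappedDiv {P : Type*} (G : Graph α β) (i : V(G) → P) (f : P → ℤ) (x : P) : ℤ :=
  ∑ᶠ y : P, (Set.ncard {e | ∃ a b, G.IsLink e a.1 b.1 ∧ i a = x ∧ i b = y} : ℤ) * (f y - f x)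

theorem mappedDiv_apply {P : Type*} {G : Graph α β} {i : V(G) → P} (hi : Function.Injective i)
    (f : P → ℤ) (a : V(G)) : mappedDiv G i f (i a) = graphDiv G (f ∘ i) a := by
  rw [mappedDiv, graphDiv, ← finsum_mem_univ, ← finsum_mem_inter_support_eq' (s := Set.range i),
    finsum_mem_range hi]
  · refine finsum_congr fun b => ?_
    congr 3
    ext e
    constructor
    · rintro ⟨a', b', h, ha, hb⟩
      rwa [hi ha, hi hb] at h
    · exact fun h => ⟨a, b, h, rfl, rfl⟩
  · intro y hy
    refine ⟨fun _ => trivial, fun _ => ?_⟩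
    by_contra hne
    apply hy
    have : {e | ∃ a' b, G.IsLink e a'.1 b.1 ∧ i a' = i a ∧ i b = y} = ∅ := by
      ext e
      simp only [Set.mem_ofPred_eq, Set.mem_empty_iff_false, iff_false]
      rintro ⟨_, b, _, _, rfl⟩
      exact hne ⟨b, rfl⟩
    simp only [this, Set.ncard_empty, Nat.cast_zero, zero_mul]

theorem mappedDiv_of_notMem_range {P : Type*} {G : Graph α β} {i : V(G) → P} (f : P → ℤ) {x : P}
    (hx : x ∉ Set.range i) : mappedDiv G i f x = 0 := by
  refine finsum_eq_zero_of_forall_eq_zero fun y => ?_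
  have : {e | ∃ a b, G.IsLink e a.1 b.1 ∧ i a = x ∧ i b = y} = ∅ := by
    ext e
    simp only [Set.mem_ofPred_eq, Set.mem_empty_iff_false, iff_false]
    rintro ⟨a, b, _, rfl, _⟩
    exact hx ⟨a, rfl⟩
  simp only [this, Set.ncard_empty, Nat.cast_zero, zero_mul]

/-- Each edge of the gluing comes from exactly one side. Finiteness is needed for `finsum` and
`ncard` to be additive. -/
theorem graphDiv_glueGraph {G₁ : Graph α₁ β₁} {G₂ : Graph α₂ β₂} (h₁ : IsFiniteConnectedGraph G₁)
    (h₂ : IsFiniteConnectedGraph G₂) (w : V(G₁)) (v : V(G₂)) (f : V(glueGraph G₁ G₂ w v) → ℤ)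
    (x : V(glueGraph G₁ G₂ w v)) :
    graphDiv (glueGraph G₁ G₂ w v) f x =
      mappedDiv G₁ (glueGraphLeft G₁ G₂ w v) f x + mappedDiv G₂ (glueGraphRight G₁ G₂ w v) f x := by
  have : Finite V(glueGraph G₁ G₂ w v) :=
    (h₁.finite_vertexSet.image _).union (h₂.finite_vertexSet.image _)
  have := h₁.finite_edgeSet.to_subtype
  have := h₂.finite_edgeSet.to_subtype
  rw [graphDiv, mappedDiv, mappedDiv, ← finsum_add_distrib (Set.toFinite _) (Set.toFinite _)]
  refine finsum_congr fun y => ?_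
  rw [← add_mul]
  congr 1
  set A := {e | ∃ a b, G₁.IsLink e a.1 b.1 ∧ glueGraphLeft G₁ G₂ w v a = x ∧
    glueGraphLeft G₁ G₂ w v b = y}
  set B := {e | ∃ a b, G₂.IsLink e a.1 b.1 ∧ glueGraphRight G₁ G₂ w v a = x ∧
    glueGraphRight G₁ G₂ w v b = y}
  have hAfin : A.Finite := h₁.finite_edgeSet.subset fun e ⟨a, b, h, _⟩ => h.edge_mem
  have hBfin : B.Finite := h₂.finite_edgeSet.subset fun e ⟨a, b, h, _⟩ => h.edge_mem
  have hunion : {e | (glueGraph G₁ G₂ w v).IsLink e x y} = Sum.inl '' A ∪ Sum.inr '' B := by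
    ext (e | e)
    · simp only [Set.mem_union, Set.mem_image, Sum.inl.injEq, exists_eq_right, reduceCtorEq,
        and_false, exists_false, or_false]
      constructor
      · rintro ⟨a, b, h, ha, hb⟩
        exact ⟨⟨a, h.left_mem⟩, ⟨b, h.right_mem⟩, h, Subtype.ext ha, Subtype.ext hb⟩
      · rintro ⟨a, b, h, ha, hb⟩
        exact ⟨a, b, h, congrArg Subtype.val ha, congrArg Subtype.val hb⟩
    · simp only [Set.mem_union, Set.mem_image, Sum.inr.injEq, exists_eq_right, reduceCtorEq,
        and_false, exists_false, false_or]
      constructor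
      · rintro ⟨a, b, h, ha, hb⟩
        exact ⟨⟨a, h.left_mem⟩, ⟨b, h.right_mem⟩, h, Subtype.ext ha, Subtype.ext hb⟩
      · rintro ⟨a, b, h, ha, hb⟩
        exact ⟨a, b, h, congrArg Subtype.val ha, congrArg Subtype.val hb⟩
  rw [hunion, Set.ncard_union_eq _ (hAfin.image _) (hBfin.image _),
    Set.ncard_image_of_injective _ Sum.inl_injective,
    Set.ncard_image_of_injective _ Sum.inr_injective, Nat.cast_add]
  rw [Set.disjoint_left]
  rintro _ ⟨e, -, rfl⟩ ⟨e', -, h⟩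
  exact Sum.inr_ne_inl h

theorem splitsPrincipal_glueGraph {G₁ : Graph α₁ β₁} {G₂ : Graph α₂ β₂}
    (h₁ : IsFiniteConnectedGraph G₁) (h₂ : IsFiniteConnectedGraph G₂) (w : V(G₁)) (v : V(G₂)) :
    IsPointGluing.SplitsPrincipal (glueGraphLeft G₁ G₂ w v) (glueGraphRight G₁ G₂ w v) w v
      (IsGraphPrincipal (glueGraph G₁ G₂ w v)) (IsGraphPrincipal G₁) (IsGraphPrincipal G₂) := by
  have h := isPointGluing_glueGraph G₁ G₂ w v
  set i₁ := glueGraphLeft G₁ G₂ w v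
  set i₂ := glueGraphRight G₁ G₂ w v
  have hleft (f : V(glueGraph G₁ G₂ w v) → ℤ) {a : V(G₁)} (ha : a ≠ w) :
      graphDiv (glueGraph G₁ G₂ w v) f (i₁ a) = graphDiv G₁ (f ∘ i₁) a := by
    rw [graphDiv_glueGraph h₁ h₂, mappedDiv_apply h.inj_left,
      mappedDiv_of_notMem_range _ (h.notMem_range ha), add_zero]
  have hright (f : V(glueGraph G₁ G₂ w v) → ℤ) {b : V(G₂)} (hb : b ≠ v) :
      graphDiv (glueGraph G₁ G₂ w v) f (i₂ b) = graphDiv G₂ (f ∘ i₂) b := by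
    rw [graphDiv_glueGraph h₁ h₂, mappedDiv_apply h.inj_right,
      mappedDiv_of_notMem_range _ (h.symm.notMem_range hb), zero_add]
  have hpoint (f : V(glueGraph G₁ G₂ w v) → ℤ) :
      graphDiv (glueGraph G₁ G₂ w v) f (i₁ w) =
        graphDiv G₁ (f ∘ i₁) w + graphDiv G₂ (f ∘ i₂) v := by
    rw [graphDiv_glueGraph h₁ h₂, mappedDiv_apply h.inj_left, h.point,
      mappedDiv_apply h.inj_right]
  intro E₁ E₂
  constructor
  · rintro ⟨f, hf⟩
    have hw := hf (i₁ w)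
    rw [h.add_apply_point, hpoint] at hw
    -- Only the sum of the two coefficients at the common point is prescribed; `c` is the
    -- discrepancy on the first side.
    refine ⟨graphDiv G₁ (f ∘ i₁) w - E₁ w, ⟨f ∘ i₁, fun a => ?_⟩, ⟨f ∘ i₂, fun b => ?_⟩⟩
    · by_cases ha : a = w
      · simp [ha]
      · rw [← hleft f ha, ← hf, h.add_apply_left _ _ ha, Finsupp.add_apply,
          Finsupp.single_eq_of_ne ha, add_zero]
    · by_cases hb : b = v
      · rw [hb, Finsupp.sub_apply, Finsupp.single_eq_same]
        omega
      · rw [← hright f hb, ← hf, h.add_apply_right _ _ hb, Finsupp.sub_apply,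
          Finsupp.single_eq_of_ne hb, sub_zero]
  · rintro ⟨c, ⟨f₁, hf₁⟩, ⟨f₂, hf₂⟩⟩
    -- The constant makes the two functions agree at the common point without changing their
    -- divisors.
    obtain ⟨f, hfl, hfr⟩ := h.exists_extension f₁ (fun b => f₂ b + (f₁ w - f₂ v)) (by ring)
    have el : f ∘ i₁ = f₁ := funext hfl
    have er : f ∘ i₂ = fun b => f₂ b + (f₁ w - f₂ v) := funext hfr
    have hw : (E₁.mapDomain i₁ + E₂.mapDomain i₂) (i₁ w) =
        graphDiv (glueGraph G₁ G₂ w v) f (i₁ w) := by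
      rw [h.add_apply_point, hpoint, el, er, graphDiv_add_const, ← hf₁, ← hf₂]
      simp
    refine ⟨f, fun x => ?_⟩
    rcases h.cover x with ⟨a, rfl⟩ | ⟨b, rfl⟩
    · by_cases ha : a = w
      · rw [ha, hw]
      · rw [h.add_apply_left _ _ ha, hleft f ha, el, ← hf₁, Finsupp.add_apply,
          Finsupp.single_eq_of_ne ha, add_zero]
    · by_cases hb : b = v
      · rw [hb, ← h.point, hw]
      · rw [h.add_apply_right _ _ hb, hright f hb, er, graphDiv_add_const, ← hf₂,
          Finsupp.sub_apply, Finsupp.single_eq_of_ne hb, sub_zero]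

end FiniteGraph

end ChipFiring

/-! ### Metric graphs: star charts, valences and boundedness. -/

namespace ChipFiring

section MetricGraph

open Filter Topology

variable {X : Type*} [MetricSpace X]

namespace IsStarChart

variable {x : X} {n : ℕ} {r : ℝ} {φ : Fin n → ℝ → X}

theorem dist_center (h : IsStarChart x n r φ) (i : Fin n) {t : ℝ} (ht : t ∈ Set.Ico 0 r) :
    dist (φ i t) x = t := by
  have := h.dist_same i t ht 0 ⟨le_rfl, h.pos⟩
  rwa [h.center, sub_zero, abs_of_nonneg ht.1] at this

theorem exists_pos_of_ne (h : IsStarChart x n r φ) {y : X} (hy : dist y x < r) (hne : y ≠ x) :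
    ∃ i, ∃ t, 0 < t ∧ t < r ∧ φ i t = y := by
  rcases h.surj y hy with rfl | ⟨i, t, ht, rfl⟩
  · exact absurd rfl hne
  · refine ⟨i, t, lt_of_le_of_ne ht.1 ?_, ht.2, rfl⟩
    rintro rfl
    exact hne (h.center i)

/-- Reaching another ray means passing through the centre, at distance `t`; the bound `r - t` keeps
`z` inside the chart. -/
theorem exists_same_ray (h : IsStarChart x n r φ) (i : Fin n) {t : ℝ} (ht : 0 < t) {z : X}
    (hz : dist z (φ i t) < min t (r - t)) :
    ∃ s ∈ Set.Ico 0 r, φ i s = z ∧ dist z (φ i t) = |s - t| := by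
  obtain ⟨h₁, h₂⟩ := lt_min_iff.1 hz
  have htr : t ∈ Set.Ico 0 r := ⟨ht.le, by linarith [dist_nonneg (x := z) (y := φ i t)]⟩
  have hzx : dist z x < r := by
    have := dist_triangle z (φ i t) x
    rw [h.dist_center i htr] at this
    linarith
  rcases h.surj z hzx with rfl | ⟨j, s, hs, rfl⟩
  · rw [dist_comm, h.dist_center i htr] at h₁
    exact absurd h₁ (lt_irrefl _)
  · by_cases hji : j = i
    · subst hji
      exact ⟨s, hs, rfl, h.dist_same _ s hs t htr⟩
    · rw [h.dist_ne j i hji s hs t htr] at h₁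
      linarith [hs.1]

/-- A small sphere about the centre meets each ray in a point of its own, so it counts rays without
reference to the chart. -/
theorem card_le (h : IsStarChart x n r φ) {s : ℝ} (hs : 0 < s) (hsr : s < r) {T : Finset X}
    (hT : ∀ y, dist y x = s → y ∈ T) : n ≤ T.card := by
  classical
  have hs' : s ∈ Set.Ico 0 r := ⟨hs.le, hsr⟩
  have hinj : Function.Injective fun i => φ i s := by
    intro i j hij
    by_contra hne
    have := h.dist_ne i j hne s hs' s hs'
    simp only at hij
    rw [hij, dist_self] at this
    linarith
  calc n = (Finset.univ.image fun i => φ i s).card := by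
        rw [Finset.card_image_of_injective _ hinj, Finset.card_univ, Fintype.card_fin]
    _ ≤ T.card := Finset.card_le_card fun y hy => by
        obtain ⟨i, -, rfl⟩ := Finset.mem_image.1 hy
        exact hT _ (h.dist_center i hs')

theorem valence_le (h : IsStarChart x n r φ) {n' : ℕ} {r' : ℝ} {ψ : Fin n' → ℝ → X}
    (h' : IsStarChart x n' r' ψ) : n' ≤ n := by
  classical
  obtain ⟨s, hs, hsm⟩ := exists_between (lt_min h.pos h'.pos)
  obtain ⟨h₁, h₂⟩ := lt_min_iff.1 hsm
  refine (h'.card_le hs h₂ (T := Finset.univ.image fun i => φ i s) fun y hy => ?_).trans ?_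
  · obtain ⟨i, t, ht, htr, rfl⟩ := h.exists_pos_of_ne (hy.trans_lt h₁) (by
      rintro rfl
      rw [dist_self] at hy
      linarith)
    rw [h.dist_center i ⟨ht.le, htr⟩] at hy
    exact Finset.mem_image.2 ⟨i, Finset.mem_univ _, by rw [hy]⟩
  · exact Finset.card_image_le.trans (by simp)

/-- A small sphere about an interior point of a ray contains at most the points at parameters `t +
s` and `t - s`. -/
theorem valence_le_two (h : IsStarChart x n r φ) (i : Fin n) {t : ℝ} (ht : 0 < t) (htr : t < r)
    {n' : ℕ} {r' : ℝ} {ψ : Fin n' → ℝ → X} (h' : IsStarChart (φ i t) n' r' ψ) : n' ≤ 2 := by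
  classical
  obtain ⟨s, hs, hsm⟩ := exists_between (lt_min (lt_min ht (sub_pos.2 htr)) h'.pos)
  obtain ⟨h₁, h₂⟩ := lt_min_iff.1 hsm
  refine (h'.card_le hs h₂ (T := {φ i (t + s), φ i (t - s)}) fun y hy => ?_).trans
    Finset.card_le_two
  obtain ⟨u, -, rfl, hd⟩ := h.exists_same_ray i ht (hy.trans_lt h₁)
  rw [hy] at hd
  rw [Finset.mem_insert, Finset.mem_singleton]
  rcases abs_cases (u - t) with ⟨ha, -⟩ | ⟨ha, -⟩
  · left
    congr 1
    linarith
  · right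
    congr 1
    linarith

end IsStarChart

variable (X) in
-- `B` consists of the centres of finitely many star balls covering `X`; every other point is
-- interior to a ray of one of them.
theorem exists_valence_bound [IsMetricGraph X] : ∃ (B : Finset X) (C : ℕ), 2 ≤ C ∧
    ∀ (x : X) (n : ℕ) (r : ℝ) (φ : Fin n → ℝ → X), IsStarChart x n r φ →
      n ≤ C ∧ (x ∉ B → n ≤ 2) := by
  choose N R Φ hΦ using IsMetricGraph.exists_star (X := X)
  obtain ⟨B, hB⟩ := CompactSpace.elim_nhds_subcover (fun x => Metric.ball x (R x))
    fun x => Metric.ball_mem_nhds x (hΦ x).pos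
  have htwo {x : X} (hx : x ∉ B) {n : ℕ} {r : ℝ} {φ : Fin n → ℝ → X}
      (h : IsStarChart x n r φ) : n ≤ 2 := by
    have hmem : x ∈ ⋃ y ∈ B, Metric.ball y (R y) := hB ▸ Set.mem_univ x
    simp only [Set.mem_iUnion, Metric.mem_ball] at hmem
    obtain ⟨y, hy, hxy⟩ := hmem
    obtain ⟨i, t, ht, htr, rfl⟩ := (hΦ y).exists_pos_of_ne hxy (by
      rintro rfl
      exact hx hy)
    exact (hΦ y).valence_le_two i ht htr h
  refine ⟨B, max 2 (B.sup N), le_max_left _ _, fun x n r φ h => ⟨?_, fun hx => htwo hx h⟩⟩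
  by_cases hx : x ∈ B
  · exact ((hΦ x).valence_le h).trans ((Finset.le_sup hx).trans (le_max_right _ _))
  · exact (htwo hx h).trans (le_max_left _ _)

theorem continuousAt_of_hasOrdAt {f : X → ℝ} {x : X} {k : ℤ} (h : HasOrdAt f x k) :
    ContinuousAt f x := by
  obtain ⟨n, r, φ, m, hφ, hf, -⟩ := h
  refine continuousAt_of_locally_lipschitz hφ.pos (∑ i, |(m i : ℝ)|) fun y hy => ?_
  rcases hφ.surj y hy with rfl | ⟨i, t, ht, rfl⟩
  · simp
  · rw [hφ.dist_center i ht, hf i t ht, Real.dist_eq, add_sub_cancel_left, abs_mul,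
      abs_of_nonneg ht.1]
    exact mul_le_mul_of_nonneg_right
      (Finset.single_le_sum (f := fun i => |(m i : ℝ)|) (fun _ _ => abs_nonneg _)
        (Finset.mem_univ i)) ht.1

/-- Arbitrarily close to `x`, the function `f` decreases from `x` with slope at least `q`. -/
def DescendsAt (f : X → ℝ) (q : ℝ) (x : X) : Prop :=
  ∃ᶠ y in 𝓝[≠] x, f y ≤ f x - q * dist y x

theorem descendsAt_iff_forall {f : X → ℝ} {q : ℝ} {x : X} : DescendsAt f q x ↔
    ∀ ε, 0 < ε → ∃ y, dist y x < ε ∧ y ≠ x ∧ f y ≤ f x - q * dist y x := by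
  rw [DescendsAt, (nhdsWithin_hasBasis Metric.nhds_basis_ball _).frequently_iff]
  refine forall₂_congr fun ε _ => ⟨?_, ?_⟩
  · rintro ⟨y, ⟨h₁, h₂⟩, h₃⟩
    exact ⟨y, h₁, h₂, h₃⟩
  · rintro ⟨y, h₁, h₂, h₃⟩
    exact ⟨y, ⟨h₁, h₂⟩, h₃⟩

section Linear

variable {f : X → ℝ} {x : X} {n : ℕ} {r : ℝ} {φ : Fin n → ℝ → X} {m : Fin n → ℤ}

/-- `DescendsAt` mentions no chart, so it allows slopes at nearby points, given in unrelated charts,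
to be compared. -/
theorem descendsAt_center_iff (hφ : IsStarChart x n r φ)
    (hf : ∀ i, ∀ t ∈ Set.Ico 0 r, f (φ i t) = f x + m i * t) (q : ℤ) :
    DescendsAt f q x ↔ ∃ i, m i ≤ -q := by
  rw [descendsAt_iff_forall]
  constructor
  · intro h
    obtain ⟨y, hy, hne, hle⟩ := h r hφ.pos
    obtain ⟨i, t, ht, htr, rfl⟩ := hφ.exists_pos_of_ne hy hne
    rw [hf i t ⟨ht.le, htr⟩, hφ.dist_center i ⟨ht.le, htr⟩] at hle
    refine ⟨i, ?_⟩
    have : (m i : ℝ) * t ≤ -q * t := by linarith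
    exact_mod_cast le_of_mul_le_mul_right this ht
  · rintro ⟨i, hi⟩ ε hε
    obtain ⟨t, ht, htm⟩ := exists_between (lt_min hε hφ.pos)
    obtain ⟨h₁, h₂⟩ := lt_min_iff.1 htm
    have hd := hφ.dist_center i ⟨ht.le, h₂⟩
    refine ⟨φ i t, hd.trans_lt h₁, ?_, ?_⟩
    · rw [← dist_pos, hd]
      exact ht
    · rw [hd, hf i t ⟨ht.le, h₂⟩]
      have : (m i : ℝ) ≤ -q := by exact_mod_cast hi
      nlinarith

/-- Only two directions leave an interior point of a ray: outwards with slope `m i`, and back to the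
centre with slope `-m i`. -/
theorem slope_of_descendsAt_ray (hφ : IsStarChart x n r φ)
    (hf : ∀ i, ∀ t ∈ Set.Ico 0 r, f (φ i t) = f x + m i * t) {q : ℤ} {i : Fin n} {t : ℝ}
    (ht : 0 < t) (htr : t < r) (h : DescendsAt f q (φ i t)) : m i ≤ -q ∨ q ≤ m i := by
  rw [descendsAt_iff_forall] at h
  obtain ⟨z, hz, hne, hle⟩ := h _ (lt_min ht (sub_pos.2 htr))
  obtain ⟨s, hs, rfl, hd⟩ := hφ.exists_same_ray i ht hz
  rw [hd, hf i s hs, hf i t ⟨ht.le, htr⟩] at hle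
  rcases lt_trichotomy s t with hst | rfl | hst
  · right
    rw [abs_of_neg (sub_neg.2 hst)] at hle
    have : (q : ℝ) * (t - s) ≤ m i * (t - s) := by linarith
    exact_mod_cast le_of_mul_le_mul_right this (sub_pos.2 hst)
  · exact absurd rfl hne
  · left
    rw [abs_of_pos (sub_pos.2 hst)] at hle
    have : (m i : ℝ) * (s - t) ≤ -q * (s - t) := by linarith
    exact_mod_cast le_of_mul_le_mul_right this (sub_pos.2 hst)

theorem descendsAt_ray (hφ : IsStarChart x n r φ)
    (hf : ∀ i, ∀ t ∈ Set.Ico 0 r, f (φ i t) = f x + m i * t) {q : ℤ} {i : Fin n} {t : ℝ}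
    (ht : 0 < t) (htr : t < r) (h : m i ≤ -q) : DescendsAt f q (φ i t) := by
  rw [descendsAt_iff_forall]
  intro ε hε
  obtain ⟨s, hs, hsm⟩ := exists_between (lt_min hε (sub_pos.2 htr))
  obtain ⟨h₁, h₂⟩ := lt_min_iff.1 hsm
  have hmem : t + s ∈ Set.Ico 0 r := ⟨by linarith, by linarith⟩
  have hd : dist (φ i (t + s)) (φ i t) = s := by
    rw [hφ.dist_same i _ hmem _ ⟨ht.le, htr⟩, add_sub_cancel_left, abs_of_pos hs]
  refine ⟨φ i (t + s), hd.trans_lt h₁, ?_, ?_⟩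
  · rw [← dist_pos, hd]
    exact hs
  · rw [hd, hf i _ hmem, hf i t ⟨ht.le, htr⟩]
    have : (m i : ℝ) ≤ -q := by exact_mod_cast h
    nlinarith

end Linear

theorem neg_mul_le_sum {n N : ℕ} (hn : n ≤ N) {m : Fin n → ℤ} {q : ℤ} (hq : 1 ≤ q)
    (hm : ∀ i, -q < m i) : -(N * (q - 1)) ≤ ∑ i, m i := by
  have := Finset.card_nsmul_le_sum Finset.univ m (-(q - 1)) fun i _ => by
    have := hm i
    omega
  rw [Finset.card_univ, Fintype.card_fin, nsmul_eq_mul] at this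
  have : (n : ℤ) ≤ N := by exact_mod_cast hn
  nlinarith

/-- Slopes are integers, so each of the other terms is at least `-(q - 1)`. A steep ascent `m i`
with no steep descent therefore forces a large order. -/
theorem sub_mul_le_sum {n N : ℕ} (hn : n ≤ N) {m : Fin n → ℤ} {q : ℤ} (hq : 1 ≤ q)
    (hm : ∀ i, -q < m i) (i : Fin n) : m i - (N - 1) * (q - 1) ≤ ∑ i, m i := by
  have := Finset.card_nsmul_le_sum (Finset.univ.erase i) m (-(q - 1)) fun i _ => by
    have := hm i
    omega
  rw [Finset.card_erase_of_mem (Finset.mem_univ i), Finset.card_univ, Fintype.card_fin,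
    nsmul_eq_mul, Nat.cast_sub (Nat.one_le_iff_ne_zero.2 i.pos.ne')] at this
  rw [← Finset.add_sum_erase _ _ (Finset.mem_univ i)]
  have : (n : ℤ) ≤ N := by exact_mod_cast hn
  push_cast at *
  nlinarith

/-- If `k` is huge, `f` leaves `w` along a very steep descent. Where `div f ≤ D`, a descent arriving
at a point must continue: at full steepness if the point has valence at most 2 and is off the
support of `D`, and with a controlled loss at the finitely many points of `B`. The threshold `h (j
x)` allows for one loss per point of `B` still below `x`. So the points with a descent above the
threshold have no lowest one, whereas compactness provides one. -/
theorem IsMetricGraph.boundedAt [IsMetricGraph X] (w : X) :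
    BoundedAt (IsMetricPrincipal (X := X)) w := by
  classical
  intro D
  obtain ⟨B₀, C, hC, hB₀⟩ := exists_valence_bound X
  set B := B₀ ∪ D.support with hB
  obtain ⟨d, hd0, hd⟩ : ∃ d : ℤ, 0 ≤ d ∧ ∀ x, D x ≤ d := by
    refine ⟨∑ x ∈ D.support, |D x|, Finset.sum_nonneg fun _ _ => abs_nonneg _, fun x => ?_⟩
    by_cases hx : x ∈ D.support
    · exact (le_abs_self _).trans
        (Finset.single_le_sum (f := fun x => |D x|) (fun _ _ => abs_nonneg _) hx)
    · rw [Finsupp.notMem_support_iff.1 hx]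
      exact Finset.sum_nonneg fun _ _ => abs_nonneg _
  -- The recursion pays for one crossing of `B`: a descent of slope `h (j + 1)` into a point of
  -- valence at most `C` and order at most `d` continues with slope at least `h j`.
  obtain ⟨h, h_zero, h_succ⟩ : ∃ h : ℕ → ℤ, h 0 = 1 ∧ ∀ j, h (j + 1) = C * h j + d + 1 :=
    ⟨fun j => Nat.rec 1 (fun _ a => C * a + d + 1) j, rfl, fun _ => rfl⟩
  have hC' : (2 : ℤ) ≤ C := by exact_mod_cast hC
  have h_one (j : ℕ) : 1 ≤ h j := by
    induction j with
    | zero => exact h_zero.ge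
    | succ j ih => rw [h_succ]; nlinarith
  have h_mono : Monotone h := monotone_nat_of_le_succ fun j => by
    have := h_one j
    rw [h_succ]
    nlinarith
  refine ⟨h (B.card + 1), ?_⟩
  rintro k hk ⟨F, hF, f, hf⟩
  have hk0 : 0 ≤ k := (zero_le_one.trans (h_one (B.card + 1))).trans hk
  have hord (x : X) : (D - Finsupp.single w k - F) x ≤ D x := by
    have h₁ : (0 : ℤ) ≤ F x := hF x
    have h₂ : (0 : ℤ) ≤ Finsupp.single w k x :=
      (Finsupp.single_nonneg.2 hk0 : 0 ≤ Finsupp.single w k) x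
    rw [Finsupp.sub_apply, Finsupp.sub_apply]
    omega
  have hcont : Continuous f :=
    continuous_iff_continuousAt.2 fun x => continuousAt_of_hasOrdAt (hf x)
  let j : X → ℕ := fun x => (B.filter fun b => f b < f x).card
  have j_le (x : X) : j x ≤ B.card := Finset.card_filter_le _ _
  have j_mono {x y : X} (hxy : f x ≤ f y) : j x ≤ j y :=
    Finset.card_le_card fun b hb => by
      rw [Finset.mem_filter] at hb ⊢
      exact ⟨hb.1, hb.2.trans_le hxy⟩
  have j_lt {x y : X} (hx : x ∈ B) (hxy : f x < f y) : j x < j y :=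
    Finset.card_lt_card <| by
      refine Finset.ssubset_iff_of_subset (fun b hb => ?_) |>.2 ⟨x, ?_, ?_⟩
      · rw [Finset.mem_filter] at hb ⊢
        exact ⟨hb.1, hb.2.trans hxy⟩
      · exact Finset.mem_filter.2 ⟨hx, hxy⟩
      · simp
  set S := {x | DescendsAt f (h (j x)) x}
  have hw : w ∈ S := by
    obtain ⟨n, r, φ, m, hφ, hlin, hsum⟩ := hf w
    refine (descendsAt_center_iff hφ hlin _).2 ?_
    by_contra! hno
    have h₁ := neg_mul_le_sum (hB₀ _ _ _ _ hφ).1 (h_one _) hno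
    rw [hsum, Finsupp.sub_apply, Finsupp.sub_apply, Finsupp.single_eq_same] at h₁
    have h₂ : (0 : ℤ) ≤ F w := hF w
    have h₃ := hd w
    have h₄ := h_mono (j_le w)
    rw [h_succ] at hk
    nlinarith
  -- `S` need not be closed, so the minimum is taken on its closure and then shown to be attained in
  -- `S`.
  obtain ⟨x, hx, hmin⟩ := isClosed_closure.isCompact.exists_isMinOn ⟨w, subset_closure hw⟩
    (s := closure S) hcont.continuousOn
  obtain ⟨n, r, φ, m, hφ, hlin, hsum⟩ := hf x
  have hxS : x ∈ S := by
    obtain ⟨y, hy, hyx⟩ := Metric.mem_closure_iff.1 hx r hφ.pos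
    rw [dist_comm] at hyx
    by_cases hne : y = x
    · rwa [← hne]
    obtain ⟨i, t, ht, htr, rfl⟩ := hφ.exists_pos_of_ne hyx hne
    have hle : f x ≤ f (φ i t) := hmin (subset_closure hy)
    have heq := hlin i t ⟨ht.le, htr⟩
    have h_one' := h_one (j (φ i t))
    -- The descent at the nearby point runs towards `x`: running outwards would put that point below
    -- the minimum.
    have hi : h (j (φ i t)) ≤ m i := by
      refine (slope_of_descendsAt_ray hφ hlin ht htr hy).resolve_left fun hneg => ?_
      have : (m i : ℝ) ≤ -1 := by exact_mod_cast (by omega : m i ≤ -1)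
      nlinarith
    have hlt : f x < f (φ i t) := by
      have : (1 : ℝ) ≤ m i := by exact_mod_cast h_one'.trans hi
      nlinarith
    refine (descendsAt_center_iff hφ hlin _).2 ?_
    by_contra! hno
    have hordx := hord x
    -- If `x ∈ B`, it is counted for the nearby point but not for itself, so the threshold drops by
    -- a full step. Otherwise at most one other ray exists and `D x = 0`, so nothing is lost.
    by_cases hxB : x ∈ B
    · have h₁ := sub_mul_le_sum (hB₀ _ _ _ _ hφ).1 (h_one _) hno i
      have h₂ := h_mono (Nat.succ_le_of_lt (j_lt hxB hlt))
      rw [Nat.succ_eq_add_one, h_succ] at h₂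
      have h₃ := hd x
      have h₄ := h_one (j x)
      rw [hsum] at h₁
      nlinarith
    · rw [hB, Finset.notMem_union] at hxB
      have h₁ := sub_mul_le_sum ((hB₀ _ _ _ _ hφ).2 hxB.1) (h_one _) hno i
      have h₂ := h_mono (j_mono hle)
      rw [Finsupp.notMem_support_iff.1 hxB.2] at hordx
      rw [hsum] at h₁
      replace h₁ := h₁.trans hordx
      push_cast at h₁
      linarith
  obtain ⟨i, hi⟩ := (descendsAt_center_iff hφ hlin _).1 hxS
  have hr2 : 0 < r / 2 := half_pos hφ.pos
  have hr2' : r / 2 < r := half_lt_self hφ.pos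
  have heq := hlin i (r / 2) ⟨hr2.le, hr2'⟩
  have hlt : f (φ i (r / 2)) < f x := by
    have := h_one (j x)
    have : (m i : ℝ) ≤ -1 := by exact_mod_cast (by omega : m i ≤ -1)
    nlinarith
  -- Going down can only lower `j`, hence the threshold, while the slope along the ray stays the
  -- same.
  have hmem : φ i (r / 2) ∈ S := descendsAt_ray hφ hlin hr2 hr2' (by
    have := h_mono (j_mono hlt.le)
    omega)
  exact absurd (hmin (subset_closure hmem)) (not_le.2 hlt)

end MetricGraph

end ChipFiring

/-! ### Metric graphs: orders and principal divisors on a gluing. -/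

namespace ChipFiring

section MetricGraph

variable {X : Type*} [MetricSpace X]

theorem HasOrdAt.add_const {f : X → ℝ} {x : X} {k : ℤ} (h : HasOrdAt f x k) (c : ℝ) :
    HasOrdAt (fun y => f y + c) x k := by
  obtain ⟨n, r, φ, m, hφ, hf, hk⟩ := h
  exact ⟨n, r, φ, m, hφ, fun i t ht => by simp only [hf i t ht]; ring, hk⟩

theorem IsStarChart.mono {x : X} {n : ℕ} {r r' : ℝ} {φ : Fin n → ℝ → X}
    (h : IsStarChart x n r φ) (h0 : 0 < r') (hr : r' ≤ r) : IsStarChart x n r' φ where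
  pos := h0
  center := h.center
  dist_same i s hs t ht := h.dist_same i s ⟨hs.1, hs.2.trans_le hr⟩ t ⟨ht.1, ht.2.trans_le hr⟩
  dist_ne i j hij s hs t ht :=
    h.dist_ne i j hij s ⟨hs.1, hs.2.trans_le hr⟩ t ⟨ht.1, ht.2.trans_le hr⟩
  surj y hy := by
    rcases h.surj y (hy.trans_le hr) with rfl | ⟨i, t, ht, rfl⟩
    · exact Or.inl rfl
    · rw [h.dist_center i ht] at hy
      exact Or.inr ⟨i, t, ⟨ht.1, hy⟩, rfl⟩

/-- The value of `HasOrdAt` can be computed in a star chart with rays indexed by any finite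
type. -/
theorem hasOrdAt_of_fintype {ι : Type*} [Fintype ι] {f : X → ℝ} {x : X} {r : ℝ} {φ : ι → ℝ → X}
    {m : ι → ℤ} (pos : 0 < r) (center : ∀ i, φ i 0 = x)
    (dist_same : ∀ i, ∀ s ∈ Set.Ico 0 r, ∀ t ∈ Set.Ico 0 r, dist (φ i s) (φ i t) = |s - t|)
    (dist_ne : ∀ i j, i ≠ j → ∀ s ∈ Set.Ico 0 r, ∀ t ∈ Set.Ico 0 r,
      dist (φ i s) (φ j t) = s + t)
    (surj : ∀ y, dist y x < r → y = x ∨ ∃ i, ∃ t ∈ Set.Ico 0 r, φ i t = y)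
    (hf : ∀ i, ∀ t ∈ Set.Ico 0 r, f (φ i t) = f x + m i * t) :
    HasOrdAt f x (∑ i, m i) := by
  let e := (Fintype.equivFin ι).symm
  refine ⟨Fintype.card ι, r, fun i => φ (e i), fun i => m (e i),
    ⟨pos, fun i => center _, fun i => dist_same _, fun i j hij => dist_ne _ _ (e.injective.ne hij),
      fun y hy => (surj y hy).imp_right ?_⟩, fun i => hf _, e.sum_comp m⟩
  rintro ⟨i, t, ht, rfl⟩
  exact ⟨e.symm i, t, ht, by rw [e.apply_symm_apply]⟩

/-- A map that is isometric onto a neighbourhood of a point preserves the order at this point. -/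
theorem hasOrdAt_comp_iff {Y : Type*} [MetricSpace Y] {i : X → Y} (hi : Isometry i) {a : X} {ρ : ℝ}
    (hρ : 0 < ρ) (hball : ∀ y, dist y (i a) < ρ → y ∈ Set.range i) (f : Y → ℝ) (k : ℤ) :
    HasOrdAt (f ∘ i) a k ↔ HasOrdAt f (i a) k := by
  have : Nonempty X := ⟨a⟩
  constructor
  · rintro ⟨n, r, φ, m, hφ, hf, hk⟩
    replace hf : ∀ j, ∀ t ∈ Set.Ico 0 (min r ρ), (f ∘ i) (φ j t) = (f ∘ i) a + m j * t :=
      fun j t ht => hf j t ⟨ht.1, ht.2.trans_le (min_le_left _ _)⟩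
    have hφ := hφ.mono (lt_min hφ.pos hρ) (min_le_left _ _)
    refine ⟨n, min r ρ, fun j t => i (φ j t), m,
      ⟨hφ.pos, fun j => by rw [hφ.center], fun j s hs t ht => ?_, fun j l hjl s hs t ht => ?_,
        fun y hy => ?_⟩, hf, hk⟩
    · rw [hi.dist_eq, hφ.dist_same j s hs t ht]
    · rw [hi.dist_eq, hφ.dist_ne j l hjl s hs t ht]
    · obtain ⟨x, rfl⟩ := hball y (hy.trans_le (min_le_right _ _))
      rw [hi.dist_eq] at hy
      rcases hφ.surj x hy with rfl | ⟨j, t, ht, rfl⟩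
      · exact Or.inl rfl
      · exact Or.inr ⟨j, t, ht, rfl⟩
  · rintro ⟨n, r, φ, m, hφ, hf, hk⟩
    replace hf : ∀ j, ∀ t ∈ Set.Ico 0 (min r ρ), f (φ j t) = f (i a) + m j * t :=
      fun j t ht => hf j t ⟨ht.1, ht.2.trans_le (min_le_left _ _)⟩
    have hφ := hφ.mono (lt_min hφ.pos hρ) (min_le_left _ _)
    have hinv (j : Fin n) {t : ℝ} (ht : t ∈ Set.Ico 0 (min r ρ)) :
        i (Function.invFun i (φ j t)) = φ j t :=
      Function.invFun_eq (hball _ (by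
        rw [hφ.dist_center j ht]
        exact ht.2.trans_le (min_le_right _ _)))
    refine ⟨n, min r ρ, fun j t => Function.invFun i (φ j t), m,
      ⟨hφ.pos, fun j => ?_, fun j s hs t ht => ?_, fun j l hjl s hs t ht => ?_, fun x hx => ?_⟩,
      fun j t ht => ?_, hk⟩
    · rw [hφ.center, Function.leftInverse_invFun hi.injective a]
    · rw [← hi.dist_eq, hinv j hs, hinv j ht, hφ.dist_same j s hs t ht]
    · rw [← hi.dist_eq, hinv j hs, hinv l ht, hφ.dist_ne j l hjl s hs t ht]
    · rw [← hi.dist_eq] at hx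
      rcases hφ.surj (i x) hx with h | ⟨j, t, ht, h⟩
      · exact Or.inl (hi.injective h)
      · exact Or.inr ⟨j, t, ht, by rw [h, Function.leftInverse_invFun hi.injective x]⟩
    · rw [Function.comp_apply, hinv j ht, hf j t ht, Function.comp_apply]

variable {X₁ X₂ Y : Type*} [MetricSpace X₁] [MetricSpace X₂] [MetricSpace Y]

/-- The metric space `Y` is the union of two isometric copies of `X₁` and `X₂` glued at `w = v`. -/
structure IsMetricGluing (i₁ : X₁ → Y) (i₂ : X₂ → Y) (w : X₁) (v : X₂) : Prop where
  isometry_left : Isometry i₁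
  isometry_right : Isometry i₂
  dist_left_right : ∀ a b, dist (i₁ a) (i₂ b) = dist a w + dist b v
  cover : ∀ x, (∃ a, i₁ a = x) ∨ ∃ b, i₂ b = x

theorem isMetricGluing_glueMetric (w : X₁) (v : X₂) :
    IsMetricGluing (glueMetricLeft w v) (glueMetricRight w v) w v where
  isometry_left := Metric.toGlueL_isometry _ _
  isometry_right := Metric.toGlueR_isometry _ _
  dist_left_right a b := by
    change Metric.glueDist (fun _ : Unit => w) (fun _ : Unit => v) 0 (.inl a) (.inr b) = _
    simp [Metric.glueDist]
  cover x := by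
    induction x using Quotient.inductionOn' with
    | h x =>
      rcases x with a | b
      · exact Or.inl ⟨a, rfl⟩
      · exact Or.inr ⟨b, rfl⟩

namespace IsMetricGluing

variable {i₁ : X₁ → Y} {i₂ : X₂ → Y} {w : X₁} {v : X₂}

theorem symm (h : IsMetricGluing i₁ i₂ w v) : IsMetricGluing i₂ i₁ v w where
  isometry_left := h.isometry_right
  isometry_right := h.isometry_left
  dist_left_right a b := by rw [dist_comm, h.dist_left_right, add_comm]
  cover x := (h.cover x).symm

theorem point (h : IsMetricGluing i₁ i₂ w v) : i₁ w = i₂ v := by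
  rw [← dist_eq_zero, h.dist_left_right, dist_self, dist_self, add_zero]

theorem isPointGluing (h : IsMetricGluing i₁ i₂ w v) : IsPointGluing i₁ i₂ w v where
  inj_left := h.isometry_left.injective
  inj_right := h.isometry_right.injective
  point := h.point
  cover := h.cover
  meet a b hab := by
    rw [← dist_eq_zero, h.dist_left_right] at hab
    have h₁ := dist_nonneg (x := a) (y := w)
    have h₂ := dist_nonneg (x := b) (y := v)
    exact ⟨dist_eq_zero.1 (by linarith), dist_eq_zero.1 (by linarith)⟩

theorem hasOrdAt_left (h : IsMetricGluing i₁ i₂ w v) (f : Y → ℝ) {a : X₁} (ha : a ≠ w) (k : ℤ) :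
    HasOrdAt (f ∘ i₁) a k ↔ HasOrdAt f (i₁ a) k := by
  refine hasOrdAt_comp_iff h.isometry_left (dist_pos.2 ha) (fun y hy => ?_) f k
  rcases h.cover y with ⟨x, rfl⟩ | ⟨b, rfl⟩
  · exact ⟨x, rfl⟩
  · rw [dist_comm, h.dist_left_right] at hy
    linarith [dist_nonneg (x := b) (y := v)]

/-- Shrunk to a common radius, the two charts form one star, since distances across the gluing add
up through the common point. -/
theorem hasOrdAt_point (h : IsMetricGluing i₁ i₂ w v) {f : Y → ℝ} {k₁ k₂ : ℤ}
    (h₁ : HasOrdAt (f ∘ i₁) w k₁) (h₂ : HasOrdAt (f ∘ i₂) v k₂) :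
    HasOrdAt f (i₁ w) (k₁ + k₂) := by
  obtain ⟨n₁, r₁, φ₁, m₁, hφ₁, hf₁, rfl⟩ := h₁
  obtain ⟨n₂, r₂, φ₂, m₂, hφ₂, hf₂, rfl⟩ := h₂
  have hr₁ := min_le_left r₁ r₂
  have hr₂ := min_le_right r₁ r₂
  have hpos := lt_min hφ₁.pos hφ₂.pos
  have g₁ := hφ₁.mono hpos hr₁
  have g₂ := hφ₂.mono hpos hr₂
  rw [← Fintype.sum_sumElim]
  refine hasOrdAt_of_fintype (ι := Fin n₁ ⊕ Fin n₂) (r := min r₁ r₂)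
    (φ := Sum.elim (fun j t => i₁ (φ₁ j t)) fun j t => i₂ (φ₂ j t)) hpos ?_ ?_ ?_ ?_ ?_
  · rintro (j | j)
    · exact congrArg i₁ (g₁.center j)
    · rw [h.point]
      exact congrArg i₂ (g₂.center j)
  · rintro (j | j) s hs t ht
    · exact (h.isometry_left.dist_eq _ _).trans (g₁.dist_same j s hs t ht)
    · exact (h.isometry_right.dist_eq _ _).trans (g₂.dist_same j s hs t ht)
  · rintro (j | j) (l | l) hjl s hs t ht
    · exact (h.isometry_left.dist_eq _ _).trans
        (g₁.dist_ne j l (fun e => hjl (congrArg _ e)) s hs t ht)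
    · simp only [Sum.elim_inl, Sum.elim_inr]
      rw [h.dist_left_right, g₁.dist_center j hs, g₂.dist_center l ht]
    · simp only [Sum.elim_inl, Sum.elim_inr]
      rw [dist_comm, h.dist_left_right, g₁.dist_center l ht, g₂.dist_center j hs, add_comm]
    · exact (h.isometry_right.dist_eq _ _).trans
        (g₂.dist_ne j l (fun e => hjl (congrArg _ e)) s hs t ht)
  · intro y hy
    rcases h.cover y with ⟨x, rfl⟩ | ⟨x, rfl⟩
    · rw [h.isometry_left.dist_eq] at hy
      rcases g₁.surj x hy with rfl | ⟨j, t, ht, rfl⟩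
      · exact Or.inl rfl
      · exact Or.inr ⟨Sum.inl j, t, ht, rfl⟩
    · rw [h.point, h.isometry_right.dist_eq] at hy
      rcases g₂.surj x hy with rfl | ⟨j, t, ht, rfl⟩
      · exact Or.inl h.point.symm
      · exact Or.inr ⟨Sum.inr j, t, ht, rfl⟩
  · rintro (j | j) t ht
    · exact hf₁ j t ⟨ht.1, ht.2.trans_le hr₁⟩
    · rw [h.point]
      exact hf₂ j t ⟨ht.1, ht.2.trans_le hr₂⟩

variable {n : ℕ} {r : ℝ} {φ : Fin n → ℝ → Y}

/-- If a ray changed sides, two of its points would be at distance `s + t` through the centre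
instead of `|s - t|`. -/
theorem ray_mem_range (h : IsMetricGluing i₁ i₂ w v) (hφ : IsStarChart (i₁ w) n r φ) {j : Fin n}
    {s : ℝ} (hs : 0 < s) (hsr : s < r) (hj : φ j s ∈ Set.range i₁) {t : ℝ}
    (ht : t ∈ Set.Ico 0 r) : φ j t ∈ Set.range i₁ := by
  rcases h.cover (φ j t) with ha | ⟨b, hb⟩
  · exact ha
  obtain ⟨a, ha⟩ := hj
  have hs' : s ∈ Set.Ico 0 r := ⟨hs.le, hsr⟩
  have d₁ := hφ.dist_center j hs'
  have d₂ := hφ.dist_center j ht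
  have d := hφ.dist_same j s hs' t ht
  rw [← ha, h.isometry_left.dist_eq] at d₁
  rw [← hb, h.point, h.isometry_right.dist_eq] at d₂
  rw [← ha, ← hb, h.dist_left_right, d₁, d₂] at d
  have : t = 0 := by
    rcases abs_cases (s - t) with ⟨e, -⟩ | ⟨e, -⟩ <;> linarith [ht.1]
  rw [this, hφ.center]
  exact ⟨w, rfl⟩

open scoped Classical in
-- Each ray stays on one side, which its point at parameter `r / 2` detects; the rays on the first
-- side form a chart there.
theorem hasOrdAt_restrict (h : IsMetricGluing i₁ i₂ w v) (hφ : IsStarChart (i₁ w) n r φ)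
    {f : Y → ℝ} {m : Fin n → ℤ} (hf : ∀ j, ∀ t ∈ Set.Ico 0 r, f (φ j t) = f (i₁ w) + m j * t) :
    HasOrdAt (f ∘ i₁) w (∑ j with φ j (r / 2) ∈ Set.range i₁, m j) := by
  have : Nonempty X₁ := ⟨w⟩
  have hr2 : 0 < r / 2 := half_pos hφ.pos
  have hr2' : r / 2 < r := half_lt_self hφ.pos
  have hi := h.isometry_left
  have hinv (j : {j // φ j (r / 2) ∈ Set.range i₁}) {t : ℝ} (ht : t ∈ Set.Ico 0 r) :
      i₁ (Function.invFun i₁ (φ j t)) = φ j t :=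
    Function.invFun_eq (h.ray_mem_range hφ hr2 hr2' j.2 ht)
  rw [Finset.sum_subtype _ (p := fun j => φ j (r / 2) ∈ Set.range i₁) (by simp)]
  refine hasOrdAt_of_fintype (r := r) (φ := fun j t => Function.invFun i₁ (φ j.1 t)) hφ.pos
    (fun j => ?_) (fun j s hs t ht => ?_) (fun j l hjl s hs t ht => ?_) (fun x hx => ?_)
    (fun j t ht => ?_)
  · rw [hφ.center, Function.leftInverse_invFun hi.injective w]
  · rw [← hi.dist_eq, hinv j hs, hinv j ht, hφ.dist_same j s hs t ht]
  · rw [← hi.dist_eq, hinv j hs, hinv l ht, hφ.dist_ne j l (Subtype.coe_injective.ne hjl) s hs t ht]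
  · by_cases hxw : x = w
    · exact Or.inl hxw
    rw [← hi.dist_eq] at hx
    obtain ⟨j, t, ht, htr, hj⟩ := hφ.exists_pos_of_ne hx (hi.injective.ne hxw)
    refine Or.inr ⟨⟨j, h.ray_mem_range hφ ht htr ⟨x, hj.symm⟩ ⟨hr2.le, hr2'⟩⟩, t, ⟨ht.le, htr⟩, ?_⟩
    rw [hj, Function.leftInverse_invFun hi.injective x]
  · rw [Function.comp_apply, hinv j ht, hf j t ht, Function.comp_apply]

theorem exists_hasOrdAt_of_point (h : IsMetricGluing i₁ i₂ w v) {f : Y → ℝ} {k : ℤ}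
    (hk : HasOrdAt f (i₁ w) k) :
    ∃ k₁ k₂, k₁ + k₂ = k ∧ HasOrdAt (f ∘ i₁) w k₁ ∧ HasOrdAt (f ∘ i₂) v k₂ := by
  classical
  obtain ⟨n, r, φ, m, hφ, hf, rfl⟩ := hk
  refine ⟨_, _, ?_, h.hasOrdAt_restrict hφ hf,
    h.symm.hasOrdAt_restrict (h.point ▸ hφ) (h.point ▸ hf)⟩
  rw [← Finset.sum_filter_add_sum_filter_not Finset.univ
    (fun j => φ j (r / 2) ∈ Set.range i₁) m]
  congr 1
  refine Finset.sum_congr (Finset.filter_congr fun j _ => ⟨?_, ?_⟩) fun _ _ => rfl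
  -- The test point is not the centre, so it cannot lie on both sides.
  · rintro ⟨b, hb⟩ ⟨a, ha⟩
    obtain ⟨rfl, -⟩ := h.isPointGluing.meet a b (ha.trans hb.symm)
    have := hφ.dist_center j ⟨(half_pos hφ.pos).le, half_lt_self hφ.pos⟩
    rw [← ha, dist_self] at this
    linarith [hφ.pos]
  · exact fun hj => (h.cover _).resolve_left hj

theorem splitsPrincipal (h : IsMetricGluing i₁ i₂ w v) :
    IsPointGluing.SplitsPrincipal i₁ i₂ w v (IsMetricPrincipal (X := Y))
      (IsMetricPrincipal (X := X₁)) (IsMetricPrincipal (X := X₂)) := by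
  have hp := h.isPointGluing
  intro E₁ E₂
  constructor
  · rintro ⟨f, hf⟩
    have hw := hf (i₁ w)
    rw [hp.add_apply_point] at hw
    -- Both orders come from the same chart at the common point, so their sum is the given one and
    -- uniqueness of orders is not needed.
    obtain ⟨k₁, k₂, hk, h₁, h₂⟩ := h.exists_hasOrdAt_of_point hw
    refine ⟨k₁ - E₁ w, ⟨f ∘ i₁, fun a => ?_⟩, ⟨f ∘ i₂, fun b => ?_⟩⟩
    · by_cases ha : a = w
      · rwa [ha, Finsupp.add_apply, Finsupp.single_eq_same, add_sub_cancel]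
      · rw [h.hasOrdAt_left f ha, Finsupp.add_apply, Finsupp.single_eq_of_ne ha, add_zero,
          ← hp.add_apply_left E₁ E₂ ha]
        exact hf _
    · by_cases hb : b = v
      · have : k₂ = E₂ v - (k₁ - E₁ w) := by omega
        rwa [hb, Finsupp.sub_apply, Finsupp.single_eq_same, ← this]
      · rw [h.symm.hasOrdAt_left f hb, Finsupp.sub_apply, Finsupp.single_eq_of_ne hb, sub_zero,
          ← hp.add_apply_right E₁ E₂ hb]
        exact hf _
  · rintro ⟨c, ⟨f₁, hf₁⟩, ⟨f₂, hf₂⟩⟩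
    obtain ⟨f, hfl, hfr⟩ := hp.exists_extension f₁ (fun b => f₂ b + (f₁ w - f₂ v)) (by ring)
    have el : f ∘ i₁ = f₁ := funext hfl
    have er : f ∘ i₂ = fun b => f₂ b + (f₁ w - f₂ v) := funext hfr
    have hord₁ (a : X₁) : HasOrdAt (f ∘ i₁) a ((E₁ + Finsupp.single w c) a) := el ▸ hf₁ a
    have hord₂ (b : X₂) : HasOrdAt (f ∘ i₂) b ((E₂ - Finsupp.single v c) b) :=
      er ▸ (hf₂ b).add_const _
    have hw : HasOrdAt f (i₁ w) ((E₁.mapDomain i₁ + E₂.mapDomain i₂) (i₁ w)) := by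
      have := h.hasOrdAt_point (hord₁ w) (hord₂ v)
      rw [Finsupp.add_apply, Finsupp.sub_apply, Finsupp.single_eq_same, Finsupp.single_eq_same,
        add_add_sub_cancel] at this
      rwa [hp.add_apply_point]
    refine ⟨f, fun x => ?_⟩
    rcases h.cover x with ⟨a, rfl⟩ | ⟨b, rfl⟩
    · by_cases ha : a = w
      · rwa [ha]
      · have := hord₁ a
        rwa [h.hasOrdAt_left f ha, Finsupp.add_apply, Finsupp.single_eq_of_ne ha, add_zero,
          ← hp.add_apply_left E₁ E₂ ha] at this
    · by_cases hb : b = v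
      · rwa [hb, ← h.point]
      · have := hord₂ b
        rwa [h.symm.hasOrdAt_left f hb, Finsupp.sub_apply, Finsupp.single_eq_of_ne hb, sub_zero,
          ← hp.add_apply_right E₁ E₂ hb] at this

end IsMetricGluing

end MetricGraph

end ChipFiring

/-! ### The formula for finite and for metric graphs. -/

open scoped Graph in
theorem mainTheorem5 :
    (∀ {α₁ α₂ β₁ β₂ : Type*} (G₁ : Graph α₁ β₁) (G₂ : Graph α₂ β₂),
      ChipFiring.IsFiniteConnectedGraph G₁ → ChipFiring.IsFiniteConnectedGraph G₂ →
      ∀ (w₁ : V(G₁)) (v₂ : V(G₂)) (D₁ : ChipFiring.Divisor V(G₁)) (D₂ : ChipFiring.Divisor V(G₂))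
        (D : ChipFiring.Divisor V(ChipFiring.glueGraph G₁ G₂ w₁ v₂)),
      D = D₁.mapDomain (ChipFiring.glueGraphLeft G₁ G₂ w₁ v₂)
          + D₂.mapDomain (ChipFiring.glueGraphRight G₁ G₂ w₁ v₂) →
      IsLeast
        (Set.range fun l : ℤ =>
          ChipFiring.graphRank G₁ (D₁ - Finsupp.single w₁ (l + 1))
            + ChipFiring.graphRank G₂ (D₂ + Finsupp.single v₂ l) + 1)
        (ChipFiring.graphRank (ChipFiring.glueGraph G₁ G₂ w₁ v₂) D)) ∧
    (∀ {X₁ X₂ : Type*} [MetricSpace X₁] [MetricSpace X₂]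
      [ChipFiring.IsMetricGraph X₁] [ChipFiring.IsMetricGraph X₂]
      (w₁ : X₁) (v₂ : X₂) (D₁ : ChipFiring.Divisor X₁) (D₂ : ChipFiring.Divisor X₂)
      (D : ChipFiring.Divisor (ChipFiring.GlueMetric w₁ v₂)),
      D = D₁.mapDomain (ChipFiring.glueMetricLeft w₁ v₂)
          + D₂.mapDomain (ChipFiring.glueMetricRight w₁ v₂) →
      IsLeast
        (Set.range fun l : ℤ =>
          ChipFiring.metricRank (D₁ - Finsupp.single w₁ (l + 1))
            + ChipFiring.metricRank (D₂ + Finsupp.single v₂ l) + 1)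
        (ChipFiring.metricRank D)) := by
  refine ⟨?_, ?_⟩
  · rintro α₁ α₂ β₁ β₂ G₁ G₂ h₁ h₂ w v D₁ D₂ _ rfl
    exact (ChipFiring.isPointGluing_glueGraph G₁ G₂ w v).isLeast_bakerNorineRank
      (ChipFiring.splitsPrincipal_glueGraph h₁ h₂ w v) (h₁.boundedAt w) (h₂.boundedAt v) D₁ D₂
  · rintro X₁ X₂ _ _ _ _ w v D₁ D₂ _ rfl
    have h := ChipFiring.isMetricGluing_glueMetric w v
    exact h.isPointGluing.isLeast_bakerNorineRank h.splitsPrincipal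
      (ChipFiring.IsMetricGraph.boundedAt w) (ChipFiring.IsMetricGraph.boundedAt v) D₁ D₂
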